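/- Let $G$ be an infinite set and let $A=(A(x,y))_{x,y\in G}$ be a matrix with entries in $\{0,1\}$. Let $Gr(A)$ be the directed graph with vertex set $G$ and an edge from $x$ to $y$ whenever $A(x,y)=1$. A path from $x$ to $y$ is a finite sequence $x_1\cdots x_n$ ($n\ge 1$) in $G$ with $x_1=x$, $x_n=y$ and $A(x_i,x_{i+1})=1$ for $1\le i<n$. The graph $Gr(A)$ is called transitive if for all $x,y\in G$ there is a path from $x$ to $y$. Let $\mathbb F$ be the free group generated by $G$, with unit $e$ and reduced word length $|\cdot|$. Identify subsets of $\mathbb F$ with points of $\{0,1\}^{\mathbb F}$ (product topology), let $\Omega_e=\{\xi\subseteq\mathbb F: e\in\xi\}$, and for $t\in\mathbb F$ let $1_t\in C(\Omega_e)$ be the characteristic function of $\{\xi\in\Omega_e: t\in\xi\}$. For finite $X,Y\subseteq G$ and $j\in G$ put $A(X,Y,j)=\prod_{x\in X}A(x,j)\prod_{y\in Y}(1-A(y,j))$. Let $R_A\subseteq C(\Omega_e)$ be the set of the following functions: 1. $1_x1_y$ for $x,y\in G$ with $x\ne y$; 2. $1_{x^{-1}}1_y-A(x,y)1_y$ for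 $x,y\in G$; 3. $1_{ts}1_t-1_{ts}$ for $t,s\in\mathbb F$ with $|ts|=|t|+|s|$; 4. $\prod_{x\in X}1_{x^{-1}}\prod_{y\in Y}(1-1_{y^{-1}})-\sum_{j\in G}A(X,Y,j)1_j$ for finite $X,Y\subseteq G$ such that $A(X,Y,j)\neq0$ for only finitely many $j\in G$. Let $\widetilde\Omega_A=\{\xi\in\Omega_e: f(t^{-1}\xi)=0\text{ for all }t\in\xi\text{ and } f\in R_A\}$, with the subspace topology. Let $U\subseteq\widetilde\Omega_A$ be the set of those $\xi$ that contain some $x\in G$; such an $x$ is then unique, and $\sigma:U\to\widetilde\Omega_A$ is defined by $\sigma(\xi)=x^{-1}\xi$. For $n\in\mathbb N=\{0,1,2,\dots\}$ let $\sigma^n$ be the $n$-fold composition of $\sigma$ with its natural domain ($\sigma^0$ is the identity of $\widetilde\Omega_A$), and for $i\ne j$ in $\mathbb N$ let $V^{i,j}=\{\xi\in\operatorname{dom}(\sigma^i)\cap\operatorname{dom}(\sigma^j):\sigma^i(\xi)=\sigma^j(\xi)\}$. The pair $(\widetilde\Omega_A,\sigma)$ is called topologically free if for all $i\neq j$ in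 $\mathbb N$ the closure of $V^{i,j}$ in $\widetilde\Omega_A$ has empty interior. **Proposition.** If $Gr(A)$ is transitive, then $(\widetilde\Omega_A,\sigma)$ is topologically free. -/

import Mathlib

noncomputable section

namespace InfiniteCK

/-! ### Partially defined maps and topological freeness -/

/-- The `n`-th iterate `σⁿ` of a partially defined map `σ : U ⊆ X → X`, with its natural domain:
`dom σ⁰ = X`, and `x ∈ dom σⁿ⁺¹` iff `x ∈ dom σⁿ` and `σⁿ(x) ∈ dom σ`. -/
def iter {X : Type*} (σ : X →. X) : ℕ → (X →. X)
  | 0 => PFun.id X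
  | n + 1 => σ.comp (iter σ n)

/-- `V^{i,j}`: the points of `dom σⁱ ∩ dom σʲ` at which `σⁱ` and `σʲ` agree. -/
def coincidenceSet {X : Type*} (σ : X →. X) (i j : ℕ) : Set X :=
  {x | ∃ y, y ∈ iter σ i x ∧ y ∈ iter σ j x}

/-- `(X, σ)` is topologically free: for all `i ≠ j` the closure of `V^{i,j}` has empty interior. -/
def IsTopologicallyFree {X : Type*} [TopologicalSpace X] (σ : X →. X) : Prop :=
  ∀ i j : ℕ, i ≠ j → interior (closure (coincidenceSet σ i j)) = ∅

/-! ### The graph of a zero-one matrix -/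

variable {G : Type*}

/-- The matrix `A` has all its entries in `{0, 1}`. -/
def IsZeroOne (A : Matrix G G ℤ) : Prop :=
  ∀ x y, A x y = 0 ∨ A x y = 1

/-- The list `p = x₁ ⋯ xₙ` (`n ≥ 1`) is a path from `x` to `y` in the graph of `A`:
`x₁ = x`, `xₙ = y` and `A(xᵢ, xᵢ₊₁) = 1` for each `i`. -/
def IsPath (A : Matrix G G ℤ) (x y : G) (p : List G) : Prop :=
  p.head? = some x ∧ p.getLast? = some y ∧ p.IsChain (fun a b => A a b = 1)

/-- The graph of `A` is transitive. -/
def IsTransitive (A : Matrix G G ℤ) : Prop :=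
  ∀ x y : G, ∃ p : List G, IsPath A x y p

/-! ### The space `Ω̃_A` -/

variable (G) in
/-- `Ω_e`: the subsets of the free group on `G` that contain the unit, seen as elements of
`{0,1}^𝔽`, with the topology induced by the product topology. -/
abbrev OmegaE : Type _ := {ξ : FreeGroup G → Bool // ξ 1 = true}

/-- Membership of `t` in the subset `ξ` of the free group. -/
def OmegaE.Has (ξ : OmegaE G) (t : FreeGroup G) : Prop := ξ.1 t = true

/-- For `t ∈ ξ`, the translate `t⁻¹ξ = {s | ts ∈ ξ}`, which again contains the unit. -/
def OmegaE.translate (ξ : OmegaE G) (t : FreeGroup G) (ht : ξ.Has t) : OmegaE G :=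
  ⟨fun s => ξ.1 (t * s), (congrArg ξ.1 (mul_one t)).trans ht⟩

/-- `1_t ∈ C(Ω_e)`: the characteristic function of `{ξ ∈ Ω_e | t ∈ ξ}`. -/
def ind (t : FreeGroup G) : C(OmegaE G, ℂ) where
  toFun ξ := if ξ.1 t = true then 1 else 0
  continuous_toFun :=
    (continuous_of_discreteTopology (f := fun b : Bool => if b = true then (1 : ℂ) else 0)).comp
      ((continuous_apply t).comp continuous_subtype_val)

/-- The number of generators in the reduced form of `t`. -/
def wordLength (t : FreeGroup G) : ℕ :=
  haveI := Classical.decEq G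
  t.norm

/-- `A(X, Y, j) = ∏_{x ∈ X} A(x, j) ∏_{y ∈ Y} (1 - A(y, j))`. -/
def coeff (A : Matrix G G ℤ) (X Y : Finset G) (j : G) : ℤ :=
  (∏ x ∈ X, A x j) * ∏ y ∈ Y, (1 - A y j)

/-- The set `R_A ⊆ C(Ω_e)` of defining relations. -/
inductive Relations (A : Matrix G G ℤ) : C(OmegaE G, ℂ) → Prop
  | orth (x y : G) (hxy : x ≠ y) :
      Relations A (ind (FreeGroup.of x) * ind (FreeGroup.of y))
  | edge (x y : G) :
      Relations A (ind (FreeGroup.of x)⁻¹ * ind (FreeGroup.of y)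
        - (A x y : ℂ) • ind (FreeGroup.of y))
  | convex (t s : FreeGroup G) (hts : wordLength (t * s) = wordLength t + wordLength s) :
      Relations A (ind (t * s) * ind t - ind (t * s))
  | sum (X Y : Finset G) (h : {j | coeff A X Y j ≠ 0}.Finite) :
      Relations A ((∏ x ∈ X, ind (FreeGroup.of x)⁻¹) * (∏ y ∈ Y, (1 - ind (FreeGroup.of y)⁻¹))
        - ∑ j ∈ h.toFinset, (coeff A X Y j : ℂ) • ind (FreeGroup.of j))

/-- `Ω̃_A = {ξ ∈ Ω_e | f(t⁻¹ξ) = 0 for all t ∈ ξ and f ∈ R_A}`. -/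
def OmegaTilde (A : Matrix G G ℤ) : Set (OmegaE G) :=
  {ξ | ∀ (t : FreeGroup G) (ht : ξ.Has t) (f : C(OmegaE G, ℂ)),
    Relations A f → f (ξ.translate t ht) = 0}

theorem translate_mem (A : Matrix G G ℤ) {ξ : OmegaE G} (hξ : ξ ∈ OmegaTilde A)
    (t : FreeGroup G) (ht : ξ.Has t) : ξ.translate t ht ∈ OmegaTilde A := by
  intro s hs f hf
  have hts : ξ.Has (t * s) := hs
  have h : (ξ.translate t ht).translate s hs = ξ.translate (t * s) hts := by
    apply Subtype.ext
    funext r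
    simp [OmegaE.translate, mul_assoc]
  rw [h]
  exact hξ _ hts f hf

/-! ### The shift -/

/-- The shift `σ : U → Ω̃_A`, where `U` is the set of those `ξ ∈ Ω̃_A` that contain some `x ∈ G`,
and `σ(ξ) = x⁻¹ξ` for the unique `x ∈ G` that lies in `ξ`. -/
def shift (A : Matrix G G ℤ) : OmegaTilde A →. OmegaTilde A := fun ξ =>
  ⟨∃ x : G, ξ.1.Has (FreeGroup.of x),
    fun h => ⟨ξ.1.translate (FreeGroup.of h.choose) h.choose_spec, translate_mem A ξ.2 _ _⟩⟩

/-- An element of `Ω̃_A` contains at most one generator. -/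
theorem generator_unique (A : Matrix G G ℤ) (ξ : OmegaTilde A) {x y : G}
    (hx : ξ.1.Has (FreeGroup.of x)) (hy : ξ.1.Has (FreeGroup.of y)) : x = y := by
  by_contra hxy
  have h1 : ξ.1.Has 1 := ξ.1.2
  have h := ξ.2 1 h1 _ (Relations.orth x y hxy)
  have hx' : ξ.1.1 (FreeGroup.of x) = true := hx
  have hy' : ξ.1.1 (FreeGroup.of y) = true := hy
  simp [ind, OmegaE.translate, hx', hy'] at h

theorem shift_eq (A : Matrix G G ℤ) (ξ : OmegaTilde A) (x : G)
    (hx : ξ.1.Has (FreeGroup.of x)) :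
    shift A ξ = Part.some ⟨ξ.1.translate (FreeGroup.of x) hx, translate_mem A ξ.2 _ _⟩ := by
  refine Part.eq_some_iff.2 ⟨⟨x, hx⟩, ?_⟩
  have h : ∃ x : G, ξ.1.Has (FreeGroup.of x) := ⟨x, hx⟩
  have e : h.choose = x := generator_unique A ξ h.choose_spec hx
  simp only [shift]
  congr 3

end InfiniteCK

end

/-! If `i < j` and `σⁱ(ξ) = σʲ(ξ)`, then `ξ` can be shifted forever, so its successive generators
form an infinite path, its stem. The relations force `ξ` to be the set of group elements whose
partial action on infinite paths is defined at the stem (`HasStem.eq_toPoint`). The stem is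
eventually periodic, so all its vertices occur before time `j`. A nonempty open subset of the
closure of `V^{i,j}` would contain such a point. Since `G` is infinite, some vertex `g` is missed by
its stem before time `j`; by transitivity the stem can be redirected to `g` after any late time. The
redirected points converge to the original one (`InfPath.tendsto_toPoint`), so some lie in the open
set; yet visiting `g` is visible on a finite initial segment and keeps them out of the closure
(`InfPath.toPoint_notMem_closure`). -/

noncomputable section

namespace InfiniteCK

variable {G : Type*} {A : Matrix G G ℤ}

/-! ### Iterates of a partially defined map -/

theorem mem_iter_succ {X : Type*} {σ : X →. X} {n : ℕ} {x z : X} :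
    z ∈ iter σ (n + 1) x ↔ ∃ y ∈ iter σ n x, z ∈ σ y :=
  Part.mem_bind_iff

theorem mem_iter_add {X : Type*} {σ : X →. X} {m n : ℕ} {x y z : X} (hy : y ∈ iter σ m x) :
    z ∈ iter σ (m + n) x ↔ z ∈ iter σ n y := by
  induction n generalizing z with
  | zero =>
    change z ∈ iter σ m x ↔ z ∈ Part.some y
    rw [Part.mem_some_iff]
    exact ⟨fun h => Part.mem_unique h hy, fun h => h ▸ hy⟩
  | succ n ih => rw [← add_assoc, mem_iter_succ, mem_iter_succ]; simp only [ih]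

theorem exists_mem_iter_of_le {X : Type*} {σ : X →. X} {m n : ℕ} (hmn : m ≤ n) {x : X}
    (h : ∃ z, z ∈ iter σ n x) : ∃ y, y ∈ iter σ m x := by
  induction hmn with
  | refl => exact h
  | step _ ih =>
    obtain ⟨z, hz⟩ := h
    obtain ⟨y, hy, -⟩ := mem_iter_succ.1 hz
    exact ih ⟨y, hy⟩

theorem coincidenceSet_comm {X : Type*} (σ : X →. X) (i j : ℕ) :
    coincidenceSet σ i j = coincidenceSet σ j i :=
  Set.ext fun _ => exists_congr fun _ => and_comm

/-- The common value is fixed by the iterate of order `j - i`, so it can be shifted arbitrarily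
often. -/
theorem exists_mem_iter_of_mem_coincidenceSet {X : Type*} {σ : X →. X} {i j : ℕ} (hij : i < j)
    {x : X} (h : x ∈ coincidenceSet σ i j) (n : ℕ) : ∃ y, y ∈ iter σ n x := by
  obtain ⟨y, h1, h2⟩ := h
  obtain ⟨p, rfl⟩ := Nat.exists_eq_add_of_lt hij
  rw [add_assoc, mem_iter_add h1] at h2
  have h3 (k : ℕ) : y ∈ iter σ (k * (p + 1)) y := by
    induction k with
    | zero => rw [zero_mul]; exact Part.mem_some y
    | succ k ih => rw [Nat.succ_mul, mem_iter_add ih]; exact h2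
  exact exists_mem_iter_of_le (show n ≤ i + n * (p + 1) by nlinarith)
    ⟨y, (mem_iter_add h1).2 (h3 n)⟩

/-! ### Infinite paths -/

/-- The infinite paths in the graph of `A`. -/
def InfPath (A : Matrix G G ℤ) : Type _ :=
  {ω : ℕ → G // ∀ n, A (ω n) (ω (n + 1)) = 1}

namespace InfPath

/-- The path obtained by deleting the first vertex. -/
def tail (ω : InfPath A) : InfPath A :=
  ⟨fun n => ω.1 (n + 1), fun n => ω.2 (n + 1)⟩

/-- The path obtained by adding a first vertex. -/
def cons (x : G) (ω : InfPath A) (h : A x (ω.1 0) = 1) : InfPath A :=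
  ⟨fun n => Nat.casesOn n x ω.1, fun n => by
    cases n with
    | zero => exact h
    | succ n => exact ω.2 n⟩

theorem ext_head_tail {ω ω' : InfPath A} (h0 : ω.1 0 = ω'.1 0) (ht : ω.tail = ω'.tail) :
    ω = ω' := by
  apply Subtype.ext
  funext n
  cases n with
  | zero => exact h0
  | succ n => exact congrFun (congrArg Subtype.val ht) n

theorem tail_iterate_apply (ω : InfPath A) (i n : ℕ) : (tail^[i] ω).1 n = ω.1 (i + n) := by
  induction i generalizing ω with
  | zero => simp
  | succ i ih =>
    rw [Function.iterate_succ_apply, ih]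
    exact congrArg ω.1 (by omega)

/-! ### The partial action of the free group on infinite paths -/

/-- The action of a letter: `(x, true)` deletes the first vertex `x`, and `(x, false)` adds `x` as
a new first vertex. -/
def Step (a : G × Bool) (ω ω' : InfPath A) : Prop :=
  match a with
  | (x, true) => ω.1 0 = x ∧ ω' = ω.tail
  | (x, false) => ω'.1 0 = x ∧ ω = ω'.tail

/-- The action of a word, letter by letter. -/
def Run : List (G × Bool) → InfPath A → InfPath A → Prop
  | [], ω, ω' => ω = ω'
  | a :: L, ω, ω' => ∃ κ, Step a ω κ ∧ Run L κ ω'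

theorem Step.not {x : G} {b : Bool} {ω ω' : InfPath A} (h : Step (x, b) ω ω') :
    Step (x, !b) ω' ω := by
  cases b <;> exact h

theorem Step.cancel {x : G} {b : Bool} {ω ω' κ : InfPath A} (h : Step (x, b) ω κ)
    (h' : Step (x, !b) κ ω') : ω = ω' := by
  cases b with
  | true => exact ext_head_tail (h.1.trans h'.1.symm) (h.2.symm.trans h'.2)
  | false => exact h.2.trans h'.2.symm

theorem run_append {L M : List (G × Bool)} {ω ω' : InfPath A} :
    Run (L ++ M) ω ω' ↔ ∃ κ, Run L ω κ ∧ Run M κ ω' := by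
  induction L generalizing ω with
  | nil => simp [Run]
  | cons a L ih =>
    simp only [List.cons_append, Run, ih]
    constructor
    · rintro ⟨κ, h, μ, h1, h2⟩
      exact ⟨μ, ⟨κ, h, h1⟩, h2⟩
    · rintro ⟨μ, ⟨κ, h, h1⟩, h2⟩
      exact ⟨κ, h, μ, h1, h2⟩

/-- A cancelling pair acts as a restriction of the identity, so deleting it can only enlarge the
domain. The converse can fail. -/
theorem Run.red_step {L M : List (G × Bool)} {ω ω' : InfPath A} (h : Run L ω ω')
    (hLM : FreeGroup.Red.Step L M) : Run M ω ω' := by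
  cases hLM with
  | @not L₁ L₂ x b =>
    obtain ⟨κ, h1, μ, h2, ν, h3, h4⟩ := run_append.1 h
    obtain rfl := h2.cancel h3
    exact run_append.2 ⟨κ, h1, h4⟩

theorem Run.red {L M : List (G × Bool)} {ω ω' : InfPath A} (h : Run L ω ω')
    (hLM : FreeGroup.Red L M) : Run M ω ω' := by
  induction hLM with
  | refl => exact h
  | tail _ h' ih => exact ih.red_step h'

theorem Run.invRev {L : List (G × Bool)} {ω ω' : InfPath A} (h : Run L ω ω') :
    Run (FreeGroup.invRev L) ω' ω := by
  induction L generalizing ω with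
  | nil => exact Eq.symm h
  | cons a L ih =>
    obtain ⟨κ, h1, h2⟩ := h
    rw [FreeGroup.invRev_cons]
    exact run_append.2 ⟨κ, ih h2, ω, h1.not, rfl⟩

/-- The action of an element of the free group, through any word that represents it. -/
def Moves (t : FreeGroup G) (ω ω' : InfPath A) : Prop :=
  ∃ L, FreeGroup.mk L = t ∧ Run L ω ω'

theorem Moves.one (ω : InfPath A) : Moves 1 ω ω := ⟨[], rfl, rfl⟩

theorem Moves.inv {t : FreeGroup G} {ω ω' : InfPath A} (h : Moves t ω ω') : Moves t⁻¹ ω' ω := by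
  obtain ⟨L, rfl, h⟩ := h
  exact ⟨FreeGroup.invRev L, FreeGroup.inv_mk.symm, h.invRev⟩

theorem Moves.mul {s t : FreeGroup G} {ω κ ω' : InfPath A} (h : Moves s ω κ)
    (h' : Moves t κ ω') : Moves (s * t) ω ω' := by
  obtain ⟨L, rfl, h⟩ := h
  obtain ⟨M, rfl, h'⟩ := h'
  exact ⟨L ++ M, FreeGroup.mul_mk.symm, run_append.2 ⟨κ, h, h'⟩⟩

/-- Among the words representing `t`, the reduced one has the largest domain. -/
theorem moves_iff_run_toWord [DecidableEq G] {t : FreeGroup G} {ω ω' : InfPath A} :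
    Moves t ω ω' ↔ Run t.toWord ω ω' := by
  constructor
  · rintro ⟨L, rfl, h⟩
    rw [FreeGroup.toWord_mk]
    exact h.red FreeGroup.reduce.red
  · exact fun h => ⟨t.toWord, FreeGroup.mk_toWord, h⟩

theorem moves_of_iff {x : G} {ω ω' : InfPath A} :
    Moves (FreeGroup.of x) ω ω' ↔ ω.1 0 = x ∧ ω' = ω.tail := by
  classical
  rw [moves_iff_run_toWord, FreeGroup.toWord_of]
  simp [Run, Step]

theorem moves_of_inv_iff {x : G} {ω ω' : InfPath A} :
    Moves (FreeGroup.of x)⁻¹ ω ω' ↔ ω'.1 0 = x ∧ ω = ω'.tail := by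
  rw [← moves_of_iff]
  exact ⟨fun h => by simpa using h.inv, fun h => h.inv⟩

/-- Whether a word acts on a path depends only on finitely many vertices of the path. -/
theorem Run.congr {L : List (G × Bool)} {ω ω' κ : InfPath A} (h : Run L ω ω') {n : ℕ}
    (hκ : ∀ k ≤ L.length + n, ω.1 k = κ.1 k) :
    ∃ κ', Run L κ κ' ∧ ∀ k ≤ n, ω'.1 k = κ'.1 k := by
  induction L generalizing ω κ with
  | nil =>
    obtain rfl : ω = ω' := h
    exact ⟨κ, rfl, fun k hk => hκ k (by simpa using hk)⟩
  | cons a L ih =>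
    obtain ⟨μ, h1, h2⟩ := h
    simp only [List.length_cons] at hκ
    obtain ⟨x, b⟩ := a
    cases b with
    | true =>
      obtain ⟨h0, rfl⟩ := h1
      obtain ⟨κ', h3, h4⟩ := ih h2 (κ := κ.tail) fun k hk => hκ (k + 1) (by omega)
      exact ⟨κ', ⟨κ.tail, ⟨(hκ 0 (by omega)).symm.trans h0, rfl⟩, h3⟩, h4⟩
    | false =>
      obtain ⟨h0, rfl⟩ := h1
      have hx : A x (κ.1 0) = 1 := by
        rw [← hκ 0 (by omega), ← h0]
        exact μ.2 0
      obtain ⟨κ', h3, h4⟩ := ih h2 (κ := κ.cons x hx) fun k hk => by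
        cases k with
        | zero => exact h0
        | succ k => exact hκ k (by omega)
      exact ⟨κ', ⟨κ.cons x hx, ⟨rfl, rfl⟩, h3⟩, h4⟩

/-! ### The point of `Ω̃_A` defined by an infinite path -/

open Classical in
/-- The set of the elements of the free group that act on `ω`. -/
def toOmegaE (ω : InfPath A) : OmegaE G :=
  ⟨fun t => decide (∃ ω', Moves t ω ω'), decide_eq_true ⟨ω, Moves.one ω⟩⟩

theorem toOmegaE_apply (ω : InfPath A) (t : FreeGroup G) :
    ω.toOmegaE.1 t = true ↔ ∃ ω', Moves t ω ω' := by
  simp [toOmegaE]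

theorem has_toOmegaE {ω : InfPath A} {t : FreeGroup G} :
    ω.toOmegaE.Has t ↔ ∃ ω', Moves t ω ω' :=
  toOmegaE_apply ω t

theorem toOmegaE_of (ω : InfPath A) (x : G) :
    ω.toOmegaE.1 (FreeGroup.of x) = true ↔ ω.1 0 = x := by
  simp [toOmegaE_apply, moves_of_iff]

theorem toOmegaE_of_inv (ω : InfPath A) (x : G) :
    ω.toOmegaE.1 (FreeGroup.of x)⁻¹ = true ↔ A x (ω.1 0) = 1 := by
  rw [toOmegaE_apply]
  constructor
  · rintro ⟨ω', h⟩
    obtain ⟨rfl, rfl⟩ := moves_of_inv_iff.1 h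
    exact ω'.2 0
  · exact fun h => ⟨ω.cons x h, moves_of_inv_iff.2 ⟨rfl, rfl⟩⟩

/-- Translating the point amounts to moving the path, so the relations need checking only at the
unit, for every path. -/
theorem translate_toOmegaE {ω ω' : InfPath A} {t : FreeGroup G} (h : Moves t ω ω')
    (ht : ω.toOmegaE.Has t) : ω.toOmegaE.translate t ht = ω'.toOmegaE := by
  apply Subtype.ext
  funext s
  rw [Bool.eq_iff_iff]
  change ω.toOmegaE.1 (t * s) = true ↔ _
  rw [toOmegaE_apply, toOmegaE_apply]
  constructor
  · rintro ⟨κ, hκ⟩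
    exact ⟨κ, by simpa using h.inv.mul hκ⟩
  · rintro ⟨κ, hκ⟩
    exact ⟨κ, h.mul hκ⟩

end InfPath

/-! ### The defining relations at the point of a path -/

theorem toWord_mul_of_wordLength [DecidableEq G] {t s : FreeGroup G}
    (h : wordLength (t * s) = wordLength t + wordLength s) :
    (t * s).toWord = t.toWord ++ s.toWord := by
  refine (FreeGroup.toWord_mul_sublist t s).eq_of_length ?_
  rw [List.length_append]
  unfold wordLength FreeGroup.norm at h
  convert h

theorem ind_apply (t : FreeGroup G) (ξ : OmegaE G) [Decidable (ξ.1 t = true)] :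
    ind t ξ = if ξ.1 t = true then 1 else 0 := by
  simp only [ind, ContinuousMap.coe_mk]
  congr

namespace InfPath

theorem relation_eq_zero (hA : IsZeroOne A) (ω : InfPath A) {f : C(OmegaE G, ℂ)}
    (hf : Relations A f) : f ω.toOmegaE = 0 := by
  classical
  have hof (x : G) : ind (FreeGroup.of x) ω.toOmegaE = if ω.1 0 = x then 1 else 0 := by
    simp only [ind_apply, toOmegaE_of]
  have hinv (x : G) : ind (FreeGroup.of x)⁻¹ ω.toOmegaE = (A x (ω.1 0) : ℂ) := by
    simp only [ind_apply, toOmegaE_of_inv]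
    rcases hA x (ω.1 0) with h | h <;> simp [h]
  cases hf with
  | orth x y hxy =>
    simp only [ContinuousMap.mul_apply, hof]
    by_cases h : ω.1 0 = x
    · have : ω.1 0 ≠ y := h ▸ hxy
      simp [this]
    · simp [h]
  | edge x y =>
    simp only [ContinuousMap.sub_apply, ContinuousMap.mul_apply, ContinuousMap.smul_apply, hof,
      hinv]
    by_cases h : ω.1 0 = y
    · simp [h]
    · simp [h]
  | convex t s hts =>
    simp only [ContinuousMap.sub_apply, ContinuousMap.mul_apply, ind_apply]
    by_cases h : ω.toOmegaE.1 (t * s) = true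
    · obtain ⟨ω', h'⟩ := (toOmegaE_apply ω _).1 h
      -- Without cancellation, running the reduced word of `t * s` runs that of `t` first.
      rw [moves_iff_run_toWord, toWord_mul_of_wordLength hts] at h'
      obtain ⟨κ, h1, -⟩ := run_append.1 h'
      have ht : ω.toOmegaE.1 t = true := (toOmegaE_apply ω _).2 ⟨κ, moves_iff_run_toWord.2 h1⟩
      simp [h, ht]
    · simp [h]
  | sum X Y h =>
    simp only [ContinuousMap.sub_apply, ContinuousMap.mul_apply, ContinuousMap.prod_apply,
      ContinuousMap.sum_apply, ContinuousMap.smul_apply, ContinuousMap.one_apply, hof, hinv]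
    have hs : ∑ j ∈ h.toFinset, (coeff A X Y j : ℂ) • (if ω.1 0 = j then (1 : ℂ) else 0)
        = coeff A X Y (ω.1 0) := by
      simp only [smul_eq_mul, mul_ite, mul_one, mul_zero, Finset.sum_ite_eq, Set.Finite.mem_toFinset,
        Set.mem_ofPred_eq]
      -- If the coefficient vanishes, `ω.1 0` is not an index of the sum, and both sides are zero.
      by_cases h0 : coeff A X Y (ω.1 0) = 0 <;> simp [h0]
    rw [hs, coeff]
    push_cast
    ring

theorem toOmegaE_mem (hA : IsZeroOne A) (ω : InfPath A) : ω.toOmegaE ∈ OmegaTilde A := by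
  intro t ht f hf
  obtain ⟨ω', h⟩ := has_toOmegaE.1 ht
  rw [translate_toOmegaE h]
  exact relation_eq_zero hA ω' hf

/-- The point of `Ω̃_A` with stem `ω`. -/
def toPoint (hA : IsZeroOne A) (ω : InfPath A) : OmegaTilde A := ⟨ω.toOmegaE, toOmegaE_mem hA ω⟩

/-- The generator in the point is the first vertex; translating by it gives the point of the tail.
-/
theorem toPoint_injective (hA : IsZeroOne A) : Function.Injective (toPoint hA) := by
  suffices H : ∀ (n : ℕ) (ω ω' : InfPath A), ω.toOmegaE = ω'.toOmegaE → ω.1 n = ω'.1 n from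
    fun ω ω' h => Subtype.ext (funext fun n => H n ω ω' (congrArg Subtype.val h))
  intro n
  induction n with
  | zero =>
    intro ω ω' h
    rw [← toOmegaE_of, h, toOmegaE_of]
  | succ n ih =>
    intro ω ω' h
    have h0 : ω.1 0 = ω'.1 0 := by rw [← toOmegaE_of, h, toOmegaE_of]
    refine ih ω.tail ω'.tail ?_
    rw [← translate_toOmegaE (moves_of_iff.2 ⟨rfl, rfl⟩) ((toOmegaE_of ω _).2 rfl),
      ← translate_toOmegaE (moves_of_iff.2 ⟨rfl, rfl⟩) ((toOmegaE_of ω' _).2 rfl)]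
    apply Subtype.ext
    funext s
    change ω.toOmegaE.1 (_ * s) = ω'.toOmegaE.1 (_ * s)
    rw [h, h0]

theorem shift_toPoint (hA : IsZeroOne A) (ω : InfPath A) :
    shift A (ω.toPoint hA) = Part.some (ω.tail.toPoint hA) := by
  rw [shift_eq A (ω.toPoint hA) (ω.1 0) ((toOmegaE_of ω _).2 rfl)]
  refine congrArg Part.some (Subtype.ext ?_)
  exact translate_toOmegaE (moves_of_iff.2 ⟨rfl, rfl⟩) ((toOmegaE_of ω _).2 rfl)

theorem iter_toPoint (hA : IsZeroOne A) (ω : InfPath A) (n : ℕ) :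
    iter (shift A) n (ω.toPoint hA) = Part.some ((tail^[n] ω).toPoint hA) := by
  induction n with
  | zero => rfl
  | succ n ih =>
    rw [Function.iterate_succ_apply', Part.eq_some_iff, mem_iter_succ]
    exact ⟨_, Part.eq_some_iff.1 ih, Part.eq_some_iff.1 (shift_toPoint hA _)⟩

theorem apply_add_of_mem_coincidenceSet (hA : IsZeroOne A) {ω : InfPath A} {i j : ℕ}
    (h : ω.toPoint hA ∈ coincidenceSet (shift A) i j) (n : ℕ) : ω.1 (i + n) = ω.1 (j + n) := by
  obtain ⟨y, h1, h2⟩ := h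
  rw [iter_toPoint, Part.mem_some_iff] at h1 h2
  rw [← tail_iterate_apply, ← tail_iterate_apply, toPoint_injective hA (h1.symm.trans h2)]

/-- The product of the first `n` vertices of a path. -/
def initial : InfPath A → ℕ → FreeGroup G
  | _, 0 => 1
  | ω, n + 1 => FreeGroup.of (ω.1 0) * initial ω.tail n

theorem has_initial_toOmegaE (ω : InfPath A) (n : ℕ) : ω.toOmegaE.Has (ω.initial n) := by
  rw [has_toOmegaE]
  suffices H : ∃ ω', Moves (ω.initial n) ω ω' from H
  induction n generalizing ω with
  | zero => exact ⟨ω, Moves.one ω⟩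
  | succ n ih =>
    obtain ⟨ω', h⟩ := ih ω.tail
    exact ⟨ω', (moves_of_iff.2 ⟨rfl, rfl⟩ : Moves (FreeGroup.of (ω.1 0)) ω ω.tail).mul h⟩

theorem apply_eq_of_has_initial {ω κ : InfPath A} {n : ℕ}
    (h : ∀ k ≤ n, κ.toOmegaE.Has (ω.initial k)) {k : ℕ} (hk : k < n) : κ.1 k = ω.1 k := by
  induction k generalizing ω κ n with
  | zero =>
    have h1 := h 1 (by omega)
    rw [initial, initial, mul_one] at h1
    exact (toOmegaE_of κ _).1 h1
  | succ k ih =>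
    have h0 : κ.1 0 = ω.1 0 := by
      have h1 := h 1 (by omega)
      rw [initial, initial, mul_one] at h1
      exact (toOmegaE_of κ _).1 h1
    obtain ⟨n, rfl⟩ : ∃ m, n = m + 1 := ⟨n - 1, by omega⟩
    refine ih (ω := ω.tail) (κ := κ.tail) (n := n) (fun l hl => ?_) (by omega)
    have hs : κ.toOmegaE.Has (FreeGroup.of (ω.1 0)) := (toOmegaE_of κ _).2 h0
    rw [← translate_toOmegaE (moves_of_iff.2 ⟨h0, rfl⟩) hs]
    exact h (l + 1) (by omega)

end InfPath

/-! ### Points with an infinite stem -/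

/-- The path `ω` is the stem of `ξ`. -/
def HasStem (ξ : OmegaE G) (ω : InfPath A) : Prop :=
  ∀ n, ξ.Has (ω.initial n)

theorem HasStem.head {ξ : OmegaE G} {ω : InfPath A} (h : HasStem ξ ω) :
    ξ.Has (FreeGroup.of (ω.1 0)) := by
  have := h 1
  rwa [InfPath.initial, InfPath.initial, mul_one] at this

theorem inv_has_iff (hA : IsZeroOne A) (ξ : OmegaTilde A) {x y : G}
    (hy : ξ.1.Has (FreeGroup.of y)) : ξ.1.Has (FreeGroup.of x)⁻¹ ↔ A x y = 1 := by
  classical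
  have h := ξ.2 1 ξ.1.2 _ (Relations.edge x y)
  have hy' : ξ.1.1 (FreeGroup.of y) = true := hy
  simp only [ContinuousMap.sub_apply, ContinuousMap.mul_apply, ContinuousMap.smul_apply,
    ind_apply, OmegaE.translate, one_mul, hy', if_true, mul_one, smul_eq_mul] at h
  unfold OmegaE.Has
  rcases hA x y with hxy | hxy <;> simp [hxy] at h ⊢ <;> simpa [sub_eq_zero] using h

theorem has_of_has_mul (ξ : OmegaTilde A) {t s : FreeGroup G}
    (hts : wordLength (t * s) = wordLength t + wordLength s) (h : ξ.1.Has (t * s)) :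
    ξ.1.Has t := by
  classical
  have h1 := ξ.2 1 ξ.1.2 _ (Relations.convex t s hts)
  have h' : ξ.1.1 (t * s) = true := h
  by_contra h2
  have h2' : ¬ ξ.1.1 t = true := h2
  simp only [ContinuousMap.sub_apply, ContinuousMap.mul_apply, ind_apply, OmegaE.translate,
    one_mul, h', h2', if_true] at h1
  simp at h1

theorem HasStem.step (hA : IsZeroOne A) {ξ : OmegaTilde A} {ω ω' : InfPath A}
    (h : HasStem ξ.1 ω) {a : G × Bool} (ha : InfPath.Step a ω ω') :
    ∃ ht : ξ.1.Has (FreeGroup.mk [a]), HasStem (ξ.1.translate _ ht) ω' := by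
  obtain ⟨x, b⟩ := a
  cases b with
  | true =>
    obtain ⟨rfl, rfl⟩ := ha
    exact ⟨h.head, fun n => h (n + 1)⟩
  | false =>
    obtain ⟨rfl, rfl⟩ := ha
    have hx : ξ.1.Has (FreeGroup.of (ω'.1 0))⁻¹ := (inv_has_iff hA ξ h.head).2 (ω'.2 0)
    refine ⟨hx, fun n => ?_⟩
    cases n with
    | zero => exact (ξ.1.translate _ hx).2
    | succ n =>
      change ξ.1.Has ((FreeGroup.of (ω'.1 0))⁻¹ * (FreeGroup.of (ω'.1 0) * ω'.tail.initial n))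
      rw [inv_mul_cancel_left]
      exact h n

theorem HasStem.exists_step (hA : IsZeroOne A) {ξ : OmegaTilde A} {ω : InfPath A}
    (h : HasStem ξ.1 ω) {a : G × Bool} (ha : ξ.1.Has (FreeGroup.mk [a])) :
    ∃ ω', InfPath.Step a ω ω' := by
  obtain ⟨x, b⟩ := a
  cases b with
  | true => exact ⟨ω.tail, generator_unique A ξ h.head ha, rfl⟩
  | false => exact ⟨ω.cons x ((inv_has_iff hA ξ h.head).1 ha), rfl, rfl⟩

theorem HasStem.has_of_run (hA : IsZeroOne A) {L : List (G × Bool)} {ξ : OmegaTilde A}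
    {ω ω' : InfPath A} (h : HasStem ξ.1 ω) (hL : InfPath.Run L ω ω') :
    ξ.1.Has (FreeGroup.mk L) := by
  induction L generalizing ξ ω with
  | nil => exact ξ.1.2
  | cons a L ih =>
    obtain ⟨κ, h1, h2⟩ := hL
    obtain ⟨ht, h3⟩ := h.step hA h1
    have := ih (ξ := ⟨_, translate_mem A ξ.2 _ ht⟩) h3 h2
    change ξ.1.Has (FreeGroup.mk [a] * FreeGroup.mk L) at this
    rwa [FreeGroup.mul_mk] at this

theorem wordLength_mk_of_isReduced {L : List (G × Bool)} (h : FreeGroup.IsReduced L) :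
    wordLength (FreeGroup.mk L) = L.length := by
  classical
  rw [wordLength, FreeGroup.norm, FreeGroup.toWord_mk, h.reduce_eq]

/-- Convexity puts the first letter of a reduced word in `ξ`; the stem then determines its action,
and translation leaves a shorter word. -/
theorem HasStem.run_of_has (hA : IsZeroOne A) {L : List (G × Bool)} (hL : FreeGroup.IsReduced L)
    {ξ : OmegaTilde A} {ω : InfPath A} (h : HasStem ξ.1 ω) (hξ : ξ.1.Has (FreeGroup.mk L)) :
    ∃ ω', InfPath.Run L ω ω' := by
  induction L generalizing ξ ω with
  | nil => exact ⟨ω, rfl⟩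
  | cons a L ih =>
    have hL' : FreeGroup.IsReduced L := List.IsChain.tail hL
    have hm : FreeGroup.mk (a :: L) = FreeGroup.mk [a] * FreeGroup.mk L :=
      (FreeGroup.mul_mk (L₁ := [a])).symm
    rw [hm] at hξ
    have ha : ξ.1.Has (FreeGroup.mk [a]) := by
      refine has_of_has_mul ξ ?_ hξ
      rw [← hm, wordLength_mk_of_isReduced hL, wordLength_mk_of_isReduced hL',
        wordLength_mk_of_isReduced (List.isChain_singleton a)]
      simp [add_comm]
    obtain ⟨κ, h1⟩ := h.exists_step hA ha
    obtain ⟨ht, h3⟩ := h.step hA h1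
    obtain ⟨ω', h4⟩ := ih hL' (ξ := ⟨_, translate_mem A ξ.2 _ ht⟩) h3 hξ
    exact ⟨ω', κ, h1, h4⟩

/-- A point of `Ω̃_A` with an infinite stem is determined by it. -/
theorem HasStem.eq_toPoint (hA : IsZeroOne A) {ξ : OmegaTilde A} {ω : InfPath A}
    (h : HasStem ξ.1 ω) : ξ = ω.toPoint hA := by
  classical
  apply Subtype.ext
  apply Subtype.ext
  funext t
  rw [Bool.eq_iff_iff]
  change ξ.1.Has t ↔ ω.toOmegaE.Has t
  rw [InfPath.has_toOmegaE]
  constructor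
  · intro ht
    rw [← FreeGroup.mk_toWord (x := t)] at ht
    obtain ⟨ω', h'⟩ := h.run_of_has hA FreeGroup.isReduced_toWord ht
    exact ⟨ω', InfPath.moves_iff_run_toWord.2 h'⟩
  · rintro ⟨ω', L, rfl, h'⟩
    exact h.has_of_run hA h'

theorem exists_of_mem_shift {ξ ζ : OmegaTilde A} (h : ζ ∈ shift A ξ) :
    ∃ (x : G) (hx : ξ.1.Has (FreeGroup.of x)), ζ.1 = ξ.1.translate (FreeGroup.of x) hx := by
  obtain ⟨⟨x, hx⟩, -⟩ := id h
  rw [shift_eq A ξ x hx, Part.mem_some_iff] at h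
  exact ⟨x, hx, congrArg Subtype.val h⟩

theorem exists_hasStem (hA : IsZeroOne A) {ξ : OmegaTilde A}
    (h : ∀ n, ∃ ζ, ζ ∈ iter (shift A) n ξ) : ∃ ω : InfPath A, HasStem ξ.1 ω := by
  choose ζ hζ using h
  have hs (n : ℕ) : ζ (n + 1) ∈ shift A (ζ n) := by
    obtain ⟨y, hy, hy'⟩ := mem_iter_succ.1 (hζ (n + 1))
    rwa [Part.mem_unique (hζ n) hy]
  choose x hx hx' using fun n => exists_of_mem_shift (hs n)
  -- The unit of `ζ n` becomes the inverse of `x n` in `ζ (n + 1)`, where the edge relation applies.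
  have hpath (n : ℕ) : A (x n) (x (n + 1)) = 1 := by
    rw [← inv_has_iff hA (ζ (n + 1)) (hx (n + 1)), hx' n]
    change (ζ n).1.1 _ = true
    rw [mul_inv_cancel]
    exact (ζ n).1.2
  have h0 : ζ 0 = ξ := (Part.mem_some_iff.1 (hζ 0 : ζ 0 ∈ Part.some ξ))
  refine ⟨⟨x, hpath⟩, fun n => ?_⟩
  rw [← h0]
  suffices H : ∀ n (ω : InfPath A) m, (∀ k, ω.1 k = x (m + k)) → (ζ m).1.Has (ω.initial n) from
    H n _ 0 fun k => by rw [zero_add]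
  intro n
  induction n with
  | zero => exact fun ω m _ => (ζ m).1.2
  | succ n ih =>
    intro ω m hω
    have := ih ω.tail (m + 1) fun k => (hω (k + 1)).trans (congrArg x (by omega))
    rw [hx' m] at this
    rw [InfPath.initial, hω 0]
    exact this

theorem exists_toPoint_of_mem_coincidenceSet (hA : IsZeroOne A) {i j : ℕ} (hij : i < j)
    {ξ : OmegaTilde A} (h : ξ ∈ coincidenceSet (shift A) i j) :
    ∃ ω : InfPath A, ω.toPoint hA = ξ ∧ ∀ n, ω.1 (i + n) = ω.1 (j + n) := by
  obtain ⟨ω, hω⟩ := exists_hasStem hA (exists_mem_iter_of_mem_coincidenceSet hij h)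
  obtain rfl := hω.eq_toPoint hA
  exact ⟨ω, rfl, InfPath.apply_add_of_mem_coincidenceSet hA h⟩

/-- A time `m ≥ j` can be lowered by the period `j - i` without changing the value. -/
theorem exists_lt_of_eventually_periodic {X : Type*} {f : ℕ → X} {i j : ℕ} (hij : i < j)
    (h : ∀ n, f (i + n) = f (j + n)) (m : ℕ) : ∃ k < j, f m = f k := by
  induction m using Nat.strong_induction_on with
  | _ m ih =>
    by_cases hm : m < j
    · exact ⟨m, hm, rfl⟩
    · obtain ⟨k, hk, e⟩ := ih (i + (m - j)) (by omega)
      refine ⟨k, hk, ?_⟩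
      rw [← e, h]
      exact congrArg f (by omega)

/-! ### Paths in a transitive graph -/

theorem IsTransitive.exists_edge [Infinite G] (h : IsTransitive A) (x : G) :
    ∃ y, A x y = 1 := by
  obtain ⟨z, hz⟩ := exists_ne x
  obtain ⟨p, h1, h2, h3⟩ := h x z
  match p, h1, h2, h3 with
  | [a], h1, h2, _ =>
    simp only [List.head?_cons, List.getLast?_singleton, Option.some.injEq] at h1 h2
    exact absurd (h2.symm.trans h1) hz
  | a :: b :: p, h1, _, h3 =>
    simp only [List.head?_cons, Option.some.injEq] at h1
    exact ⟨b, h1 ▸ (List.isChain_cons_cons.1 h3).1⟩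

theorem IsTransitive.exists_infPath [Infinite G] (h : IsTransitive A) (x : G) :
    ∃ ω : InfPath A, ω.1 0 = x := by
  choose s hs using h.exists_edge
  refine ⟨⟨fun n => s^[n] x, fun n => ?_⟩, rfl⟩
  change A (s^[n] x) (s^[n + 1] x) = 1
  rw [Function.iterate_succ_apply']
  exact hs _

theorem IsPath.exists_infPath {x y : G} {p : List G} (hp : IsPath A x y p) {κ : InfPath A}
    (hκ : κ.1 0 = y) : ∃ ω : InfPath A, ω.1 0 = x ∧ ∃ m, ω.1 m = y := by
  obtain ⟨h1, h2, h3⟩ := hp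
  induction p generalizing x with
  | nil => simp at h1
  | cons a p ih =>
    simp only [List.head?_cons, Option.some.injEq] at h1
    subst h1
    cases p with
    | nil =>
      simp only [List.getLast?_singleton, Option.some.injEq] at h2
      exact ⟨κ, hκ.trans h2.symm, 0, hκ⟩
    | cons b p =>
      rw [List.isChain_cons_cons] at h3
      rw [List.getLast?_cons_cons] at h2
      obtain ⟨ω, h4, m, hm⟩ := ih rfl h2 h3.2
      exact ⟨ω.cons a (by rw [h4]; exact h3.1), rfl, m + 1, hm⟩

/-- In a transitive graph, a path can be redirected after any time to visit a given vertex. -/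
theorem IsTransitive.exists_redirect [Infinite G] (h : IsTransitive A) (ω : InfPath A) (g : G)
    (n : ℕ) : ∃ κ : InfPath A, (∀ k ≤ n, κ.1 k = ω.1 k) ∧ ∃ m, κ.1 m = g := by
  induction n generalizing ω with
  | zero =>
    obtain ⟨p, hp⟩ := h (ω.1 0) g
    obtain ⟨μ, hμ⟩ := h.exists_infPath g
    obtain ⟨κ, h1, h2⟩ := hp.exists_infPath hμ
    exact ⟨κ, fun k hk => by rwa [Nat.le_zero.1 hk], h2⟩
  | succ n ih =>
    obtain ⟨κ, h1, m, hm⟩ := ih ω.tail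
    refine ⟨κ.cons (ω.1 0) (by rw [h1 0 (Nat.zero_le _)]; exact ω.2 0), fun k hk => ?_, m + 1, hm⟩
    cases k with
    | zero => rfl
    | succ k => exact h1 k (by omega)

/-! ### Topological freeness -/

open Filter Topology

/-- Points with infinite stems depend continuously on the stem. -/
theorem InfPath.tendsto_toPoint (hA : IsZeroOne A) {ω : InfPath A} {κ : ℕ → InfPath A}
    (h : ∀ n, ∀ k ≤ n, (κ n).1 k = ω.1 k) :
    Tendsto (fun n => (κ n).toPoint hA) atTop (𝓝 (ω.toPoint hA)) := by
  classical
  rw [tendsto_subtype_rng, tendsto_subtype_rng, tendsto_pi_nhds]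
  intro t
  refine tendsto_const_nhds.congr' ?_
  filter_upwards [eventually_ge_atTop t.toWord.length] with n hn
  rw [Bool.eq_iff_iff]
  change ω.toOmegaE.1 t = true ↔ (κ n).toOmegaE.1 t = true
  rw [toOmegaE_apply, toOmegaE_apply]
  simp only [moves_iff_run_toWord]
  constructor
  · rintro ⟨ω', hω⟩
    obtain ⟨κ', h1, -⟩ := hω.congr (κ := κ n) (n := 0) fun k hk => (h n k (by omega)).symm
    exact ⟨κ', h1⟩
  · rintro ⟨ω', hω⟩
    obtain ⟨κ', h1, -⟩ := hω.congr (κ := ω) (n := 0) fun k hk => h n k (by omega)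
    exact ⟨κ', h1⟩

theorem isOpen_setOf_has (t : FreeGroup G) : IsOpen {ξ : OmegaTilde A | ξ.1.Has t} := by
  have hc : Continuous fun ξ : OmegaTilde A => ξ.1.1 t :=
    (continuous_apply t).comp (continuous_subtype_val.comp continuous_subtype_val)
  exact (isOpen_discrete {true}).preimage hc

/-- A point whose stem visits, at some time, a vertex not visited before time `j` is not in the
closure of `V^{i,j}`. -/
theorem InfPath.toPoint_notMem_closure (hA : IsZeroOne A) {i j : ℕ} (hij : i < j)
    {ω : InfPath A} {m : ℕ} (hm : ∀ k < j, ω.1 m ≠ ω.1 k) :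
    ω.toPoint hA ∉ closure (coincidenceSet (shift A) i j) := by
  intro hcl
  -- Long enough for agreement before time `n` to cover time `m` and all times before `j`.
  set n := m + j + 1
  have hopen : IsOpen (⋂ k ∈ Finset.range (n + 1), {ξ : OmegaTilde A | ξ.1.Has (ω.initial k)}) :=
    isOpen_biInter_finset fun k _ => isOpen_setOf_has _
  obtain ⟨ξ, h1, h2⟩ := mem_closure_iff.1 hcl _ hopen
    (Set.mem_iInter₂.2 fun k _ => ω.has_initial_toOmegaE k)
  obtain ⟨κ, rfl, hκ⟩ := exists_toPoint_of_mem_coincidenceSet hA hij h2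
  have hag (k : ℕ) (hk : k < n) : κ.1 k = ω.1 k :=
    apply_eq_of_has_initial (n := n)
      (fun l hl => Set.mem_iInter₂.1 h1 l (Finset.mem_range.2 (by omega))) hk
  obtain ⟨k, hk, e⟩ := exists_lt_of_eventually_periodic hij hκ m
  rw [hag m (by omega), hag k (by omega)] at e
  exact hm k hk e

theorem interior_closure_coincidenceSet [Infinite G] (hA : IsZeroOne A) (h : IsTransitive A)
    {i j : ℕ} (hij : i < j) : interior (closure (coincidenceSet (shift A) i j)) = ∅ := by
  classical
  rw [Set.eq_empty_iff_forall_notMem]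
  intro ξ₀ hξ₀
  -- The open interior meets `V^{i,j}` itself, which supplies a point with an infinite stem.
  obtain ⟨ξ, hξ, hV⟩ :=
    mem_closure_iff.1 (interior_subset hξ₀) _ isOpen_interior hξ₀
  obtain ⟨ω, rfl, -⟩ := exists_toPoint_of_mem_coincidenceSet hA hij hV
  obtain ⟨g, hg⟩ := Infinite.exists_notMem_finset ((Finset.range j).image ω.1)
  choose κ hκ m hm using h.exists_redirect ω g
  have hev := (InfPath.tendsto_toPoint hA hκ).eventually (isOpen_interior.mem_nhds hξ)
  -- Redirecting no earlier than time `j` leaves the vertices before `j` unchanged, so `g` is still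
  -- new.
  obtain ⟨n, hn, hnj⟩ := (hev.and (eventually_ge_atTop j)).exists
  refine InfPath.toPoint_notMem_closure hA hij (m := m n) (fun k hk e => hg ?_)
    (interior_subset hn)
  rw [hm, hκ n k (by omega)] at e
  exact Finset.mem_image.2 ⟨k, Finset.mem_range.2 hk, e.symm⟩

end InfiniteCK

end

theorem proposition4p10 {G : Type*} [Infinite G] (A : Matrix G G ℤ)
    (hA : InfiniteCK.IsZeroOne A) (htrans : InfiniteCK.IsTransitive A) :
    InfiniteCK.IsTopologicallyFree (InfiniteCK.shift A) := by
  intro i j hij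
  rcases hij.lt_or_gt with h | h
  · exact InfiniteCK.interior_closure_coincidenceSet hA htrans h
  · rw [InfiniteCK.coincidenceSet_comm]
    exact InfiniteCK.interior_closure_coincidenceSet hA htrans h
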